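/- Let $d\ge 1$ and let $z_1,z_2,\dots$ be i.i.d. random vectors in $\mathbb{R}^d$ with law $\gamma$. The support $\mathcal D$ of $\gamma$ is contained in the open cube $(-1,1)^d$ (so it is compact and bounded away from the boundary of $[-1,1]^d$), $\gamma$ is absolutely continuous with respect to Lebesgue measure, and its density is bounded away from $0$ on $\mathcal D$. Let $\mathcal L(z,\theta)$ be a loss with parameter in $\mathbb{R}^m$, and fix $\theta$ such that $\mathcal L(z,\cdot)$ is differentiable at $\theta$ for every $z\in\mathcal D$ and $z\mapsto\nabla_\theta\mathcal L(z,\theta)$ is $\gamma$-integrable. Put $\Xi_N=\frac1N\sum_{i=1}^N\nabla_\theta\mathcal L(z_i,\theta)$. Let $k:\mathbb{R}^d\to\mathbb{R}$ be measurable and integrable with $\int k=1$ and compact support, and for each $N$ let $h=h_N>0$ be a bandwidth and $p=p_N\ge1$ an integer, with $h_N\to0$ as $N\to\infty$. Let $q(x)=q_1(x_1)\cdots q_d(x_d)$, where each $q_j$ is a probability density on $[-1,1]$ that is positive almost everywhere on $[-1,1]$, and assume that $q$ is bounded on $\mathcal D$. Enumerate the monomials in $d$ variables in some order (for instance the graded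 lexicographic one), let $\varphi_0,\varphi_1,\dots$ be the orthonormal polynomials obtained from them by the Gram-Schmidt algorithm in $L^2(q(x)\,dx)$, and let $K_q^{(p)}(x,y)=\sum_{j=0}^{p-1}\varphi_j(x)\varphi_j(y)$. For each $N$ let $A=A_N$ be a random finite subset of $\mathbb{R}^d$, independent of $\mathfrak D=(z_1,\dots,z_N)$, that is a determinantal point process with kernel $K_q^{(p)}$ and reference measure $q(x)\,dx$ (the multivariate orthogonal polynomial ensemble), and define $$\Xi_{A,\mathrm s}=\sum_{w\in A}\frac{\widehat{\nabla_\theta\mathcal L}(w,\theta)}{q(w)K_q^{(p)}(w,w)},\qquad \widehat{\nabla_\theta\mathcal L}(w,\theta)=\frac1{Nh^d}\sum_{i=1}^N\nabla_\theta\mathcal L(z_i,\theta)\,k\!\left(\frac{w-z_i}{h}\right).$$ Then $\Xi_{A,\mathrm s}$ is integrable for every $N\ge1$, and $$\mathbb{E}[\Xi_{A,\mathrm s}\mid\mathfrak D]=\Xi_N+\mathcal O_P(ph/N)\qquad(N\to\infty),$$ that is, for every $\varepsilon>0$ there is $M>0$ such that $\mathbb P\big(\|\mathbb{E}[\Xi_{A,\mathrm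 s}\mid\mathfrak D]-\Xi_N\|>M\,p_Nh_N/N\big)\le\varepsilon$ for all large $N$. Moreover the bias only comes from data points close to the boundary: if $k(x)=0$ whenever $\|x\|_\infty>R$, then for every $N\ge1$, almost surely, $$\mathbb{E}[\Xi_{A,\mathrm s}\mid\mathfrak D]-\Xi_N=\frac1N\sum_{i:\ \mathrm{dist}_\infty(z_i,\partial[-1,1]^d)\le Rh}\left(\int_{[-1,1]^d}h^{-d}k\!\left(\frac{w-z_i}{h}\right)dw-1\right)\nabla_\theta\mathcal L(z_i,\theta).$$ -/

import Mathlib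

open MeasureTheory ProbabilityTheory Filter Topology

noncomputable section

/-- The σ-algebra on the finite subsets of `X` that is generated by the counting maps
`S ↦ #(S ∩ B)`, `B` measurable: the usual one for point processes. (The instance on `Finset X` only
looks at the events `x ∈ S` for single points `x`, which is too coarse when `X` is uncountable.) -/
abbrev configurationSigma (X : Type*) [MeasurableSpace X] : MeasurableSpace (Finset X) :=
  ⨆ B : {B : Set X // MeasurableSet B},
    MeasurableSpace.comap (fun S : Finset X => ((S : Set X) ∩ B.1).ncard) ⊤

open Classical in
/-- The sum of `f` over all `n`-tuples of pairwise distinct elements of `S`. -/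
def sumDistinct {X : Type*} {n : ℕ} (f : (Fin n → X) → ℝ) (S : Finset X) : ℝ :=
  ∑ x ∈ (Fintype.piFinset fun _ : Fin n => S).filter Function.Injective, f x

/-- The random finite subset `S` of `X` (on the probability space `(Ω, P)`) is a determinantal
point process with kernel `K` and reference measure `μ`: for every `n ≥ 1` and every bounded
Borel `f`, the expectation of the sum of `f` over the pairwise distinct `n`-tuples of `S`
is `∫ f(x₁, …, xₙ) det[K(xᵢ, xⱼ)] dμ^{⊗n}` (both integrals being finite). -/
structure IsDPP {Ω X : Type*} [MeasurableSpace Ω] [MeasurableSpace X] (P : Measure Ω)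
    (S : Ω → Finset X) (K : X → X → ℝ) (μ : Measure X) : Prop where
  measurable : Measurable[_, configurationSigma X] S
  correlation : ∀ n : ℕ, 1 ≤ n → ∀ f : (Fin n → X) → ℝ, Measurable f →
    (∃ C : ℝ, ∀ x, |f x| ≤ C) →
      Integrable (fun ω => sumDistinct f (S ω)) P ∧
      Integrable (fun x : Fin n → X => f x * (Matrix.of fun i j => K (x i) (x j)).det)
        (Measure.pi fun _ => μ) ∧
      ∫ ω, sumDistinct f (S ω) ∂P =
        ∫ x : Fin n → X, f x * (Matrix.of fun i j => K (x i) (x j)).det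
          ∂(Measure.pi fun _ => μ)

/-- The `L²(μ)` inner product of two polynomials in `d` variables. -/
def polyInner {d : ℕ} (μ : Measure (Fin d → ℝ)) (f g : MvPolynomial (Fin d) ℝ) : ℝ :=
  ∫ x, MvPolynomial.eval x f * MvPolynomial.eval x g ∂μ

/-- The orthonormal polynomials with respect to `μ`: Gram-Schmidt in `L²(μ)`, with normalization,
applied to the monomials in the order in which `e` enumerates them. -/
def orthoPoly {d : ℕ} (μ : Measure (Fin d → ℝ)) (e : ℕ ≃ (Fin d →₀ ℕ)) :
    ℕ → MvPolynomial (Fin d) ℝ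
  | n =>
    let m : MvPolynomial (Fin d) ℝ := MvPolynomial.monomial (e n) 1
    let ψ : MvPolynomial (Fin d) ℝ :=
      m - ∑ i : Fin n, polyInner μ m (orthoPoly μ e i) • orthoPoly μ e i
    (Real.sqrt (polyInner μ ψ ψ))⁻¹ • ψ
  termination_by n => n
  decreasing_by all_goals exact i.isLt

/-- The product function `q(x) = q₁(x₁) ⋯ q_d(x_d)`. -/
def prodDensity {d : ℕ} (q : Fin d → ℝ → ℝ) (x : Fin d → ℝ) : ℝ := ∏ j, q j (x j)

/-- The measure `q(x) dx`. -/
def densityMeasure {d : ℕ} (q : Fin d → ℝ → ℝ) : Measure (Fin d → ℝ) :=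
  volume.withDensity fun x => ENNReal.ofReal (prodDensity q x)

/-- The kernel `K_q^{(p)}(x, y) = ∑_{k < p} φ_k(x) φ_k(y)` of the multivariate orthogonal
polynomial ensemble associated with `q(x) dx` (monomials enumerated by `e`). -/
def opeKernel {d : ℕ} (q : Fin d → ℝ → ℝ) (e : ℕ ≃ (Fin d →₀ ℕ)) (p : ℕ)
    (x y : Fin d → ℝ) : ℝ :=
  ∑ n ∈ Finset.range p, MvPolynomial.eval x (orthoPoly (densityMeasure q) e n) *
    MvPolynomial.eval y (orthoPoly (densityMeasure q) e n)

/-- `Ξ_N = N⁻¹ ∑ᵢ ∇_θ L(zᵢ, θ)`. -/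
def empiricalGradient {d m N : ℕ} (L : (Fin d → ℝ) → EuclideanSpace ℝ (Fin m) → ℝ)
    (θ : EuclideanSpace ℝ (Fin m)) (z : Fin N → Fin d → ℝ) : EuclideanSpace ℝ (Fin m) :=
  (N : ℝ)⁻¹ • ∑ i, gradient (L (z i)) θ

/-- The kernel-smoothed gradient `(N h^d)⁻¹ ∑ᵢ k((w - zᵢ)/h) ∇_θ L(zᵢ, θ)`. -/
def smoothedGradient {d m N : ℕ} (L : (Fin d → ℝ) → EuclideanSpace ℝ (Fin m) → ℝ)
    (θ : EuclideanSpace ℝ (Fin m)) (k : (Fin d → ℝ) → ℝ) (h : ℝ) (z : Fin N → Fin d → ℝ)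
    (w : Fin d → ℝ) : EuclideanSpace ℝ (Fin m) :=
  ((N : ℝ) * h ^ d)⁻¹ • ∑ i, k (h⁻¹ • (w - z i)) • gradient (L (z i)) θ

/-- The smoothed estimator `Ξ_{A,s}`: the sum over `w ∈ A` of the smoothed gradient at `w` divided
by `q(w) K_q^{(p)}(w, w)`. -/
def smoothedEstimator {d m N : ℕ} (L : (Fin d → ℝ) → EuclideanSpace ℝ (Fin m) → ℝ)
    (θ : EuclideanSpace ℝ (Fin m)) (k : (Fin d → ℝ) → ℝ) (h : ℝ) (q : Fin d → ℝ → ℝ)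
    (e : ℕ ≃ (Fin d →₀ ℕ)) (p : ℕ) (z : Fin N → Fin d → ℝ) (A : Finset (Fin d → ℝ)) :
    EuclideanSpace ℝ (Fin m) :=
  ∑ w ∈ A, (prodDensity q w * opeKernel q e p w w)⁻¹ • smoothedGradient L θ k h z w

/-- The data set made of the first `N` observations. -/
def dataset {Ω : Type*} {d : ℕ} (z : ℕ → Ω → Fin d → ℝ) (N : ℕ) (ω : Ω) : Fin N → Fin d → ℝ :=
  fun i => z i ω

/-- The σ-algebra generated by the first `N` observations. -/
abbrev dataSigma {Ω : Type*} {d : ℕ} (z : ℕ → Ω → Fin d → ℝ) (N : ℕ) : MeasurableSpace Ω :=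
  MeasurableSpace.comap (dataset z N) inferInstance

/-- The difference `E[Ξ_{A,s} | z₁, …, z_N] - Ξ_N`, a random variable. -/
def conditionalBias {Ω : Type*} [MeasurableSpace Ω] (P : Measure Ω) {d m : ℕ}
    (L : (Fin d → ℝ) → EuclideanSpace ℝ (Fin m) → ℝ) (θ : EuclideanSpace ℝ (Fin m))
    (k : (Fin d → ℝ) → ℝ) (h : ℝ) (q : Fin d → ℝ → ℝ) (e : ℕ ≃ (Fin d →₀ ℕ)) (p : ℕ)
    (z : ℕ → Ω → Fin d → ℝ) (N : ℕ) (A : Ω → Finset (Fin d → ℝ)) (ω : Ω) :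
    EuclideanSpace ℝ (Fin m) :=
  (P[fun ω' => smoothedEstimator L θ k h q e p (dataset z N ω') (A ω') | dataSigma z N]) ω -
    empiricalGradient L θ (dataset z N ω)

/-- The cube `[-1, 1]^d`. -/
def cube (d : ℕ) : Set (Fin d → ℝ) := Set.Icc (fun _ => -1) (fun _ => 1)

/-- `X_N = O_P(a_N)` as `N → ∞`. -/
def IsBigOInProbability {Ω G : Type*} [MeasurableSpace Ω] [NormedAddCommGroup G] (P : Measure Ω)
    (X : ℕ → Ω → G) (a : ℕ → ℝ) : Prop :=
  ∀ ε : ℝ, 0 < ε → ∃ M : ℝ, 0 < M ∧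
    ∀ᶠ N in atTop, P {ω | M * a N < ‖X N ω‖} ≤ ENNReal.ofReal ε

end

/-! By Campbell's formula, the correlation identity for `n = 1`, the points of `A` have intensity
`q(w) K(w, w) dw`. The weights of the estimator are the inverse of this density, which is positive
a.e. on the cube and zero outside. Since `A` is independent of the data, the conditional mean is
therefore the Lebesgue integral over the cube of the smoothed gradient (`IsDPP.intensity`,
`condExp_integral_kernel_of_indepFun`, `integral_withDensity_inv_smul`).

In that integral each data point contributes its gradient times the mass that its rescaled smoothing
kernel puts in the cube. The mass is 1 once the ball of radius `R h` around the point fits in the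
cube, so only points near the boundary produce bias. The support of `γ` is compact in the open cube
and `h → 0`, so for large `N` the bias is almost surely zero; the bound in probability follows, with
any nonnegative rate. -/

/-! ### Point processes as random counting measures -/

/-- Finite subsets of `X` as points of a measurable space, with the point process σ-algebra. -/
def Configuration (X : Type*) : Type _ := Finset X

/-- The underlying finite set of a configuration. -/
def Configuration.points {X : Type*} (S : Configuration X) : Finset X := S

noncomputable instance Configuration.instMeasurableSpace (X : Type*) [MeasurableSpace X] :
    MeasurableSpace (Configuration X) :=
  configurationSigma X

theorem Configuration.measurable_ncard {X : Type*} [MeasurableSpace X] {B : Set X}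
    (hB : MeasurableSet B) :
    Measurable fun S : Configuration X => ((S.points : Set X) ∩ B).ncard := by
  have h : (MeasurableSpace.comap (fun S : Finset X => ((S : Set X) ∩ B).ncard) ⊤) ≤
      configurationSigma X :=
    le_iSup (fun B : {B : Set X // MeasurableSet B} =>
      MeasurableSpace.comap (fun S : Finset X => ((S : Set X) ∩ B.1).ncard) ⊤) ⟨B, hB⟩
  intro t _
  exact h _ ⟨t, trivial, rfl⟩

theorem sum_dirac_apply {X : Type*} [MeasurableSpace X] (S : Finset X) {B : Set X}
    (hB : MeasurableSet B) :
    (∑ w ∈ S, Measure.dirac w) B = (((S : Set X) ∩ B).ncard : ENNReal) := by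
  classical
  have : ((S : Set X) ∩ B) = ((S.filter (· ∈ B) : Finset X) : Set X) := by
    ext; simp
  rw [this, Set.ncard_coe_finset, Measure.finsetSum_apply]
  simp [Measure.dirac_apply' _ hB, Set.indicator_apply]

/-- The counting measure of a configuration, as a kernel. -/
noncomputable def countingKernel (X : Type*) [MeasurableSpace X] : Kernel (Configuration X) X where
  toFun S := ∑ w ∈ S.points, Measure.dirac w
  measurable' := by
    refine Measure.measurable_of_measurable_coe _ fun B hB => ?_
    simp_rw [sum_dirac_apply _ hB]
    exact (measurable_from_nat (f := fun n : ℕ => (n : ENNReal))).comp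
      (Configuration.measurable_ncard hB)

theorem countingKernel_apply {X : Type*} [MeasurableSpace X] (S : Configuration X) :
    countingKernel X S = ∑ w ∈ S.points, Measure.dirac w := rfl

theorem integral_countingKernel {X E : Type*} [MeasurableSpace X] [MeasurableSingletonClass X]
    [NormedAddCommGroup E] [NormedSpace ℝ E] [CompleteSpace E] (f : X → E) (S : Configuration X) :
    ∫ w, f w ∂(countingKernel X S) = ∑ w ∈ S.points, f w := by
  rw [countingKernel_apply, integral_finsetSum_measure]
  · simp
  · intro w _
    exact integrable_dirac (by simp)

/-- The number of points need not be bounded, so the kernel is cut according to cardinality: the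
piece with `n` points has mass at most `n`. -/
instance countingKernel.instIsSFiniteKernel (X : Type*) [MeasurableSpace X] :
    IsSFiniteKernel (countingKernel X) := by
  classical
  have hm : ∀ n : ℕ, MeasurableSet {S : Configuration X | S.points.card = n} := by
    intro n
    have := Configuration.measurable_ncard (X := X) MeasurableSet.univ
      (MeasurableSet.singleton n)
    convert this using 1
    ext S
    have h : ((S.points : Set X) ∩ Set.univ).ncard = S.points.card := by simp
    simp only [Set.mem_preimage, Set.mem_singleton_iff, h]
    rfl
  have hfin : ∀ n, IsFiniteKernel (Kernel.piecewise (hm n) (countingKernel X) 0) := by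
    intro n
    refine ⟨⟨n, by simp, fun S => ?_⟩⟩
    rw [Kernel.piecewise_apply]
    split_ifs with h
    · have h' : S.points.card = n := h
      rw [countingKernel_apply, sum_dirac_apply _ MeasurableSet.univ]
      simp [h']
    · simp
  have hsum : countingKernel X =
      Kernel.sum fun n => Kernel.piecewise (hm n) (countingKernel X) 0 := by
    ext S B hB
    rw [Kernel.sum_apply' _ _ hB, tsum_eq_single S.points.card]
    · rw [Kernel.piecewise_apply, if_pos]
      rfl
    · intro n hn
      rw [Kernel.piecewise_apply, if_neg]
      · simp
      · exact fun h => hn (Eq.symm h)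
  rw [hsum]
  infer_instance

theorem sumDistinct_one {X : Type*} (f : (Fin 1 → X) → ℝ) (S : Finset X) :
    sumDistinct f S = ∑ w ∈ S, f fun _ => w := by
  classical
  unfold sumDistinct
  rw [Finset.filter_true_of_mem fun x _ => Function.injective_of_subsingleton x]
  refine Finset.sum_nbij' (fun x => x 0) (fun w _ => w) ?_ ?_ ?_ ?_ ?_
  · intro x hx
    exact Fintype.mem_piFinset.1 hx 0
  · intro w hw
    simpa using hw
  · intro x _
    ext i
    rw [Subsingleton.elim i 0]
  · intro w _
    rfl
  · intro x _
    congr 1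
    ext i
    rw [Subsingleton.elim i 0]

/-- Campbell's formula: the intensity of a determinantal point process with kernel `K` and
reference measure `μ` is `K(w, w) dμ(w)`. -/
theorem IsDPP.intensity {Ω X : Type*} [MeasurableSpace Ω] [MeasurableSpace X] {P : Measure Ω}
    {S : Ω → Configuration X} {K : X → X → ℝ} {μ : Measure X} [SigmaFinite μ] (hS : IsDPP P (fun ω => (S ω).points) K μ)
    (hK : ∀ w, 0 ≤ K w w) :
    countingKernel X ∘ₘ P.map S =
      μ.withDensity fun w => ENNReal.ofReal (K w w) := by
  classical
  have hSm : Measurable S := hS.measurable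
  ext B hB
  rw [Measure.bind_apply hB (Kernel.aemeasurable _), lintegral_map
    ((countingKernel X).measurable_coe hB) hSm, withDensity_apply _ hB]
  -- With `n = 1` the determinant is `K w w`; the indicator of `B` as test function makes the sum
  -- count the points in `B`.
  obtain ⟨h1, h2, h3⟩ := hS.correlation 1 le_rfl (fun x => B.indicator 1 (x 0))
    ((measurable_one.indicator hB).comp (measurable_pi_apply 0))
    ⟨1, fun x => by by_cases hx : x 0 ∈ B <;> simp [hx]⟩
  have hcount : ∀ ω, countingKernel X (S ω) B = ENNReal.ofReal
      (sumDistinct (fun x : Fin 1 → X => B.indicator (1 : X → ℝ) (x 0)) (S ω).points) := by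
    intro ω
    rw [sumDistinct_one, countingKernel_apply, Measure.finsetSum_apply,
      ENNReal.ofReal_sum_of_nonneg]
    · refine Finset.sum_congr rfl fun w _ => ?_
      rw [Measure.dirac_apply' _ hB]
      by_cases hw : w ∈ B <;> simp [hw]
    · intro w _
      by_cases hw : w ∈ B <;> simp [hw]
  have hpres : MeasurePreserving (MeasurableEquiv.funUnique (Fin 1) X)
      (Measure.pi fun _ => μ) μ := by
    convert measurePreserving_funUnique μ (Fin 1)
  have hfun : (fun x : Fin 1 → X => B.indicator (1 : X → ℝ) (x 0) *
      (Matrix.of fun i j => K (x i) (x j)).det) =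
      (fun w => B.indicator (fun w => K w w) w) ∘ MeasurableEquiv.funUnique (Fin 1) X := by
    ext x
    by_cases hx : x 0 ∈ B <;> simp [hx]
  rw [hfun] at h2 h3
  rw [hpres.integrable_comp_emb (MeasurableEquiv.measurableEmbedding _)] at h2
  have h4 := hpres.integral_comp (MeasurableEquiv.measurableEmbedding _)
    (fun w => B.indicator (fun w => K w w) w)
  simp only [Function.comp_def] at h3
  rw [h4] at h3
  simp_rw [hcount]
  rw [← ofReal_integral_eq_lintegral_ofReal h1, h3, ofReal_integral_eq_lintegral_ofReal h2,
    ← lintegral_indicator hB]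
  · refine lintegral_congr fun w => ?_
    by_cases hw : w ∈ B <;> simp [hw]
  · exact Eventually.of_forall fun w => Set.indicator_nonneg (fun w _ => hK w) w
  · refine Eventually.of_forall fun ω => ?_
    simp only [Pi.zero_apply]
    rw [sumDistinct_one]
    exact Finset.sum_nonneg fun w _ => Set.indicator_nonneg (fun _ _ => zero_le_one) _

/-! ### Conditional expectation of an integral against an independent random measure -/

section condExp

variable {Ω α β W E : Type*} [MeasurableSpace Ω] [MeasurableSpace α]
  [MeasurableSpace β] [MeasurableSpace W] [NormedAddCommGroup E] [NormedSpace ℝ E]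
  {P : Measure Ω} [IsProbabilityMeasure P] {X : Ω → α} {Y : Ω → β} {κ : Kernel β W}
  [IsSFiniteKernel κ] {f : α × W → E}

theorem StronglyMeasurable.integral_kernel_snd (hf : StronglyMeasurable f) :
    StronglyMeasurable fun p : α × β => ∫ w, f (p.1, w) ∂κ p.2 :=
  StronglyMeasurable.integral_kernel_prod_right' (κ := κ.comap Prod.snd measurable_snd)
    (f := fun r : (α × β) × W => f (r.1.1, r.2)) (hf.comp_measurable (by fun_prop))

theorem integrable_integral_kernel_snd {μ : Measure α} {ν : Measure β} [SFinite μ]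
    [SFinite ν] (hf : StronglyMeasurable f) (hfi : Integrable f (μ.prod (κ ∘ₘ ν))) :
    Integrable (fun p : α × β => ∫ w, f (p.1, w) ∂κ p.2) (μ.prod ν) := by
  refine ⟨(StronglyMeasurable.integral_kernel_snd hf).aestronglyMeasurable, ?_⟩
  have hm : Measurable fun p : α × β => ∫⁻ w, ‖f (p.1, w)‖ₑ ∂κ p.2 :=
    Measurable.lintegral_kernel_prod_right' (κ := κ.comap Prod.snd measurable_snd)
      (f := fun r : (α × β) × W => ‖f (r.1.1, r.2)‖ₑ)
      (hf.enorm.comp (by fun_prop))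
  calc ∫⁻ p : α × β, ‖∫ w, f (p.1, w) ∂κ p.2‖ₑ ∂(μ.prod ν)
      ≤ ∫⁻ p : α × β, ∫⁻ w, ‖f (p.1, w)‖ₑ ∂κ p.2 ∂(μ.prod ν) :=
        lintegral_mono fun p => enorm_integral_le_lintegral_enorm _
    _ = ∫⁻ x, ∫⁻ y, ∫⁻ w, ‖f (x, w)‖ₑ ∂κ y ∂ν ∂μ := lintegral_prod _ hm.aemeasurable
    _ = ∫⁻ x, ∫⁻ w, ‖f (x, w)‖ₑ ∂(κ ∘ₘ ν) ∂μ := by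
        refine lintegral_congr fun x => ?_
        rw [Measure.lintegral_bind (Kernel.aemeasurable _)]
        exact (hf.enorm.comp measurable_prodMk_left).aemeasurable
    _ = ∫⁻ p, ‖f p‖ₑ ∂(μ.prod (κ ∘ₘ ν)) := (lintegral_prod _ hf.enorm.aemeasurable).symm
    _ < ⊤ := hfi.2

theorem integrable_integral_kernel_of_indepFun (hX : Measurable X) (hY : Measurable Y)
    (hXY : IndepFun X Y P) (hf : StronglyMeasurable f)
    (hfi : Integrable f ((P.map X).prod (κ ∘ₘ P.map Y))) :
    Integrable (fun ω => ∫ w, f (X ω, w) ∂κ (Y ω)) P := by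
  have := Measure.isProbabilityMeasure_map (μ := P) hX.aemeasurable
  have := Measure.isProbabilityMeasure_map (μ := P) hY.aemeasurable
  have h := integrable_integral_kernel_snd hf hfi
  rw [← (indepFun_iff_map_prod_eq_prod_map_map hX.aemeasurable hY.aemeasurable).1 hXY] at h
  exact h.comp_measurable (hX.prodMk hY)

/-- Independence makes the joint law a product, so by Fubini `κ (Y ω)` may be averaged over `Y` with
`X` frozen, and the average of `κ` is `κ ∘ₘ P.map Y`. -/
theorem condExp_integral_kernel_of_indepFun [CompleteSpace E] (hX : Measurable X)
    (hY : Measurable Y)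
    (hXY : IndepFun X Y P) (hf : StronglyMeasurable f) [SFinite (κ ∘ₘ P.map Y)]
    (hfi : Integrable f ((P.map X).prod (κ ∘ₘ P.map Y))) :
    P[fun ω => ∫ w, f (X ω, w) ∂κ (Y ω) | MeasurableSpace.comap X inferInstance] =ᵐ[P]
      fun ω => ∫ w, f (X ω, w) ∂(κ ∘ₘ P.map Y) := by
  have := Measure.isProbabilityMeasure_map (μ := P) hX.aemeasurable
  have := Measure.isProbabilityMeasure_map (μ := P) hY.aemeasurable
  have hΦ := integrable_integral_kernel_snd hf hfi
  have hg : Integrable (fun x => ∫ w, f (x, w) ∂(κ ∘ₘ P.map Y)) (P.map X) :=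
    hfi.integral_prod_left
  -- Disintegrating the composed measure needs an integrable slice, which is available only for
  -- almost every `x`.
  have hslice : ∀ᵐ x ∂(P.map X), ∫ w, f (x, w) ∂(κ ∘ₘ P.map Y) =
      ∫ y, ∫ w, f (x, w) ∂κ y ∂(P.map Y) := by
    filter_upwards [hfi.prod_right_ae] with x hx
    rw [Measure.comp_eq_comp_const_apply] at hx ⊢
    simpa using Kernel.integral_comp hx
  symm
  refine ae_eq_condExp_of_forall_setIntegral_eq hX.comap_le
    (integrable_integral_kernel_of_indepFun hX hY hXY hf hfi) (fun s _ _ =>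
      (hg.comp_measurable hX).integrableOn) ?_ ?_
  · rintro s ⟨B, hB, rfl⟩ -
    have hmap := (indepFun_iff_map_prod_eq_prod_map_map hX.aemeasurable hY.aemeasurable).1 hXY
    calc ∫ ω in X ⁻¹' B, ∫ w, f (X ω, w) ∂(κ ∘ₘ P.map Y) ∂P
        = ∫ x in B, ∫ w, f (x, w) ∂(κ ∘ₘ P.map Y) ∂(P.map X) :=
          (setIntegral_map hB hg.1 hX.aemeasurable).symm
      _ = ∫ x in B, ∫ y, ∫ w, f (x, w) ∂κ y ∂(P.map Y) ∂(P.map X) :=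
          integral_congr_ae (ae_restrict_of_ae hslice)
      _ = ∫ p in B ×ˢ Set.univ, ∫ w, f (p.1, w) ∂κ p.2 ∂((P.map X).prod (P.map Y)) := by
          rw [setIntegral_prod _ hΦ.integrableOn]
          simp
      _ = ∫ p in B ×ˢ Set.univ, ∫ w, f (p.1, w) ∂κ p.2 ∂(P.map fun ω => (X ω, Y ω)) := by
          rw [hmap]
      _ = ∫ ω in X ⁻¹' B, ∫ w, f (X ω, w) ∂κ (Y ω) ∂P := by
          rw [setIntegral_map (hB.prod MeasurableSet.univ) (hmap ▸ hΦ.1)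
            (hX.prodMk hY).aemeasurable]
          congr 2
          ext; simp
  · have hsm : StronglyMeasurable fun x => ∫ w, f (x, w) ∂(κ ∘ₘ P.map Y) :=
      hf.integral_prod_right'
    exact (hsm.comp_measurable (comap_measurable X)).aestronglyMeasurable

end condExp

/-! ### Positivity of the density and of the kernel on the diagonal -/

section density

variable {d : ℕ} {q : Fin d → ℝ → ℝ}

theorem prodDensity_nonneg (hq : ∀ j t, 0 ≤ q j t) (x : Fin d → ℝ) : 0 ≤ prodDensity q x :=
  Finset.prod_nonneg fun j _ => hq j (x j)

theorem measurable_prodDensity (hq : ∀ j, Measurable (q j)) : Measurable (prodDensity q) :=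
  Finset.measurable_prod _ fun j _ => (hq j).comp (measurable_pi_apply j)

theorem prodDensity_eq_zero (hq : ∀ j, ∀ t ∉ Set.Icc (-1 : ℝ) 1, q j t = 0) {x : Fin d → ℝ}
    (hx : x ∉ cube d) : prodDensity q x = 0 := by
  simp only [cube, Set.mem_Icc, Pi.le_def, ← forall_and, not_forall] at hx
  obtain ⟨j, hj⟩ := hx
  exact Finset.prod_eq_zero (Finset.mem_univ j) (hq j _ hj)

theorem integrable_prodDensity (hq : ∀ j, Integrable (q j)) : Integrable (prodDensity q) :=
  Integrable.fintype_prod hq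

theorem isFiniteMeasure_densityMeasure (hq : ∀ j, Integrable (q j)) :
    IsFiniteMeasure (densityMeasure q) :=
  isFiniteMeasure_withDensity_ofReal (integrable_prodDensity hq).2

theorem ae_prodDensity_pos
    (hq : ∀ j, ∀ᵐ t ∂(volume.restrict (Set.Icc (-1 : ℝ) 1)), 0 < q j t) :
    ∀ᵐ x : Fin d → ℝ, x ∈ cube d → 0 < prodDensity q x := by
  have h : ∀ j, ∀ᵐ x : Fin d → ℝ, x j ∈ Set.Icc (-1 : ℝ) 1 → 0 < q j (x j) := fun j =>
    (Measure.quasiMeasurePreserving_eval (fun _ : Fin d => (volume : Measure ℝ)) j).ae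
      ((ae_restrict_iff' measurableSet_Icc).1 (hq j))
  filter_upwards [ae_all_iff.2 h] with x hx hxc
  exact Finset.prod_pos fun j _ => hx j ⟨hxc.1 j, hxc.2 j⟩

theorem measurableSet_cube (d : ℕ) : MeasurableSet (cube d) := measurableSet_Icc

theorem densityMeasure_restrict_cube (hq : ∀ j, ∀ t ∉ Set.Icc (-1 : ℝ) 1, q j t = 0) :
    (densityMeasure q).restrict (cube d) = densityMeasure q := by
  rw [densityMeasure, restrict_withDensity (measurableSet_cube d),
    ← withDensity_indicator (measurableSet_cube d)]
  congr 1
  ext x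
  by_cases hx : x ∈ cube d <;> simp [hx, prodDensity_eq_zero hq]

theorem integrable_eval_densityMeasure (hq_int : ∀ j, Integrable (q j))
    (hq : ∀ j, ∀ t ∉ Set.Icc (-1 : ℝ) 1, q j t = 0) (f : MvPolynomial (Fin d) ℝ) :
    Integrable (fun x => MvPolynomial.eval x f) (densityMeasure q) := by
  have := isFiniteMeasure_densityMeasure hq_int
  rw [← densityMeasure_restrict_cube hq]
  exact (MvPolynomial.continuous_eval f).continuousOn.integrableOn_compact isCompact_Icc

end density

theorem ae_eval_monomial_ne_zero {d : ℕ} (s : Fin d →₀ ℕ) :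
    ∀ᵐ x : Fin d → ℝ, MvPolynomial.eval x (MvPolynomial.monomial s (1 : ℝ)) ≠ 0 := by
  have h : ∀ j, ∀ᵐ x : Fin d → ℝ, x j ≠ 0 := fun j => by
    rw [volume_pi]
    exact Measure.ae_eval_ne _ j 0
  filter_upwards [ae_all_iff.2 h] with x hx
  rw [MvPolynomial.eval_monomial, one_mul, Finsupp.prod]
  exact Finset.prod_ne_zero_iff.2 fun j _ => pow_ne_zero _ (hx j)

section kernel

variable {d : ℕ} {q : Fin d → ℝ → ℝ}

theorem polyInner_monomial_self_pos (hq_meas : ∀ j, Measurable (q j))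
    (hq_out : ∀ j, ∀ t ∉ Set.Icc (-1 : ℝ) 1, q j t = 0) (hq_int : ∀ j, Integrable (q j))
    (hq_pos : ∀ j, ∀ᵐ t ∂(volume.restrict (Set.Icc (-1 : ℝ) 1)), 0 < q j t) (s : Fin d →₀ ℕ) :
    0 < polyInner (densityMeasure q) (MvPolynomial.monomial s 1) (MvPolynomial.monomial s 1) := by
  have hint : Integrable (fun x => MvPolynomial.eval x (MvPolynomial.monomial s (1 : ℝ)) *
      MvPolynomial.eval x (MvPolynomial.monomial s (1 : ℝ))) (densityMeasure q) := by
    simpa only [map_mul] using integrable_eval_densityMeasure hq_int hq_out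
      (MvPolynomial.monomial s (1 : ℝ) * MvPolynomial.monomial s (1 : ℝ))
  rw [polyInner, integral_pos_iff_support_of_nonneg (fun x => mul_self_nonneg _) hint,
    pos_iff_ne_zero]
  intro h0
  rw [densityMeasure, withDensity_apply_eq_zero
    (measurable_prodDensity hq_meas).ennreal_ofReal] at h0
  -- A zero integral would make the set where both `q` and the monomial are nonzero Lebesgue null;
  -- but it contains almost all of the cube, of volume `2 ^ d`.
  have hcube : (volume : Measure (Fin d → ℝ)) (cube d) ≠ 0 := by
    rw [cube, Real.volume_Icc_pi]
    simp only [Finset.prod_const]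
    norm_num
  refine hcube (le_antisymm (le_trans (measure_mono_ae ?_) h0.le) zero_le)
  filter_upwards [ae_eval_monomial_ne_zero s, ae_prodDensity_pos hq_pos] with x hx hqx hxc
  exact ⟨by simpa using hqx hxc, mul_ne_zero hx hx⟩

theorem orthoPoly_zero (μ : Measure (Fin d → ℝ)) (e : ℕ ≃ (Fin d →₀ ℕ)) :
    orthoPoly μ e 0 = (Real.sqrt (polyInner μ (MvPolynomial.monomial (e 0) 1)
      (MvPolynomial.monomial (e 0) 1)))⁻¹ • MvPolynomial.monomial (e 0) 1 := by
  rw [orthoPoly]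
  simp

theorem opeKernel_self_nonneg (e : ℕ ≃ (Fin d →₀ ℕ)) (p : ℕ) (x : Fin d → ℝ) :
    0 ≤ opeKernel q e p x x :=
  Finset.sum_nonneg fun _ _ => mul_self_nonneg _

theorem measurable_opeKernel_self (e : ℕ ≃ (Fin d →₀ ℕ)) (p : ℕ) :
    Measurable fun x => opeKernel q e p x x :=
  Finset.measurable_sum _ fun _ _ =>
    (MvPolynomial.continuous_eval _).measurable.mul (MvPolynomial.continuous_eval _).measurable

/-- The diagonal is a sum of squares, and its first term suffices: `φ₀` is a nonzero multiple of a
single monomial, which vanishes at most on the coordinate hyperplanes. -/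
theorem ae_opeKernel_self_pos (hq_meas : ∀ j, Measurable (q j))
    (hq_out : ∀ j, ∀ t ∉ Set.Icc (-1 : ℝ) 1, q j t = 0) (hq_int : ∀ j, Integrable (q j))
    (hq_pos : ∀ j, ∀ᵐ t ∂(volume.restrict (Set.Icc (-1 : ℝ) 1)), 0 < q j t)
    (e : ℕ ≃ (Fin d →₀ ℕ)) {p : ℕ} (hp : 1 ≤ p) :
    ∀ᵐ x : Fin d → ℝ, 0 < opeKernel q e p x x := by
  filter_upwards [ae_eval_monomial_ne_zero (e 0)] with x hx
  refine Finset.sum_pos' (fun _ _ => mul_self_nonneg _) ⟨0, Finset.mem_range.2 hp, ?_⟩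
  have hpos := polyInner_monomial_self_pos hq_meas hq_out hq_int hq_pos (e 0)
  refine mul_self_pos.2 ?_
  rw [orthoPoly_zero, MvPolynomial.smul_eval]
  exact mul_ne_zero (inv_ne_zero (Real.sqrt_pos.2 hpos).ne') hx

end kernel

/-! ### Cancelling the intensity, and the mass of the rescaled smoothing kernel -/

section reweighting

variable {W E : Type*} [MeasurableSpace W] [NormedAddCommGroup E] [NormedSpace ℝ E]
  {μ : Measure W} {ρ : W → ℝ}

theorem integral_withDensity_inv_smul (hρ : Measurable ρ) {C : Set W} (hC : MeasurableSet C)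
    (hρ_pos : ∀ᵐ w ∂μ, w ∈ C → 0 < ρ w) (hρ_out : ∀ w ∉ C, ρ w = 0) (g : W → E) :
    ∫ w, (ρ w)⁻¹ • g w ∂(μ.withDensity fun w => ENNReal.ofReal (ρ w)) = ∫ w in C, g w ∂μ := by
  rw [integral_withDensity_eq_integral_toReal_smul hρ.ennreal_ofReal (by simp),
    ← integral_indicator hC]
  refine integral_congr_ae ?_
  filter_upwards [hρ_pos] with w hw
  by_cases hwC : w ∈ C
  · rw [Set.indicator_of_mem hwC, ENNReal.toReal_ofReal (hw hwC).le,
      smul_inv_smul₀ (hw hwC).ne']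
  · rw [Set.indicator_of_notMem hwC, hρ_out w hwC]
    simp

/-- Only an inequality, so no positivity of `ρ` is needed: where `ρ ≤ 0` the density vanishes,
elsewhere the two factors cancel. -/
theorem lintegral_withDensity_inv_smul_le (hρ : Measurable ρ) (g : W → E) :
    ∫⁻ w, ‖(ρ w)⁻¹ • g w‖ₑ ∂(μ.withDensity fun w => ENNReal.ofReal (ρ w)) ≤
      ∫⁻ w, ‖g w‖ₑ ∂μ := by
  rw [lintegral_withDensity_eq_lintegral_mul_non_measurable _ hρ.ennreal_ofReal
    (Eventually.of_forall fun _ => ENNReal.ofReal_lt_top)]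
  refine lintegral_mono fun w => ?_
  simp only [Pi.mul_apply, enorm_smul, ← mul_assoc]
  refine mul_le_of_le_one_left zero_le ?_
  rcases le_or_gt (ρ w) 0 with h | h
  · simp [ENNReal.ofReal_of_nonpos h]
  · rw [Real.enorm_eq_ofReal (inv_nonneg.2 h.le), ← ENNReal.ofReal_mul h.le,
      mul_inv_cancel₀ h.ne', ENNReal.ofReal_one]

end reweighting

section smoothing

variable {d : ℕ} {k : (Fin d → ℝ) → ℝ} {h : ℝ}

theorem integrable_comp_inv_smul_sub (hk : Integrable k) (hh : 0 < h) (x : Fin d → ℝ) :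
    Integrable fun w => k (h⁻¹ • (w - x)) :=
  (hk.comp_smul (inv_ne_zero hh.ne')).comp_sub_right x

theorem lintegral_comp_inv_smul_sub (x : Fin d → ℝ) :
    ∫⁻ w, ‖k (h⁻¹ • (w - x))‖ₑ = ∫⁻ w, ‖k (h⁻¹ • w)‖ₑ :=
  lintegral_sub_right_eq_self (fun w => ‖k (h⁻¹ • w)‖ₑ) x

theorem setIntegral_rescaled_eq_one (hk_one : ∫ x, k x = 1) (hh : 0 < h) {R : ℝ}
    (hkR : ∀ x, R < ‖x‖ → k x = 0) {C : Set (Fin d → ℝ)} {x : Fin d → ℝ}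
    (hC : Metric.closedBall x (R * h) ⊆ C) :
    ∫ w in C, (h ^ d)⁻¹ * k (h⁻¹ • (w - x)) = 1 := by
  rw [setIntegral_eq_integral_of_forall_compl_eq_zero, integral_const_mul,
    integral_sub_right_eq_self (fun w => k (h⁻¹ • w)),
    Measure.integral_comp_inv_smul_of_nonneg _ _ hh.le, hk_one]
  · simp [hh.ne']
  · intro w hw
    have hd : R * h < dist w x := by
      by_contra! hle
      exact hw (hC hle)
    rw [hkR, mul_zero]
    rw [norm_smul, norm_inv, Real.norm_of_nonneg hh.le, ← dist_eq_norm, inv_mul_eq_div,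
      lt_div_iff₀ hh]
    exact hd

theorem radius_nonneg (hk_one : ∫ x, k x = 1) {R : ℝ} (hkR : ∀ x, R < ‖x‖ → k x = 0) :
    0 ≤ R := by
  by_contra! hR
  have : k = 0 := funext fun x => hkR x (hR.trans_le (norm_nonneg x))
  simp [this] at hk_one

end smoothing

/-- The ball is connected and misses the frontier, so it lies either in the interior or in the
complement of the closure; its centre decides. -/
theorem closedBall_subset_of_lt_infDist_frontier {V : Type*} [NormedAddCommGroup V]
    [NormedSpace ℝ V] {C : Set V} {x : V} {r : ℝ} (hx : x ∈ interior C) (hr : 0 ≤ r)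
    (h : r < Metric.infDist x (frontier C)) : Metric.closedBall x r ⊆ C := by
  refine subset_trans ?_ interior_subset
  refine (convex_closedBall x r).isPreconnected.subset_left_of_subset_union isOpen_interior
    (isClosed_closure (s := C)).isOpen_compl ?_ ?_ ⟨x, Metric.mem_closedBall_self hr, hx⟩
  · exact Set.disjoint_compl_right_iff_subset.2 (interior_subset.trans subset_closure)
  · intro y hy
    by_contra hcon
    simp only [Set.mem_union, Set.mem_compl_iff, not_or, not_not] at hcon
    have := Metric.infDist_le_dist_of_mem (x := x) (show y ∈ frontier C from ⟨hcon.2, hcon.1⟩)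
    rw [dist_comm] at this
    exact absurd (h.trans_le this) (not_lt.2 hy)

/-! ### Integrability and the exact conditional bias -/

/-- By Tonelli, the weight absorbs the density, and translation invariance makes the `L¹` mass of
the smoothing kernel independent of the data point. What remains is the integrability of the
gradients. -/
theorem integrable_reweighted_smoothing {d m N : ℕ} {k : (Fin d → ℝ) → ℝ} {h : ℝ}
    {ρ : (Fin d → ℝ) → ℝ} {g : (Fin d → ℝ) → EuclideanSpace ℝ (Fin m)}
    {μ : Measure (Fin N → Fin d → ℝ)} (hk_meas : Measurable k) (hk : Integrable k) (hh : 0 < h)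
    (hρ : Measurable ρ) (hg : ∀ i, Integrable (fun x => g (x i)) μ) (c : ℝ)
    (hf : StronglyMeasurable fun r : (Fin N → Fin d → ℝ) × (Fin d → ℝ) =>
      (ρ r.2)⁻¹ • ∑ i, (c * k (h⁻¹ • (r.2 - r.1 i))) • g (r.1 i)) :
    Integrable (fun r : (Fin N → Fin d → ℝ) × (Fin d → ℝ) =>
      (ρ r.2)⁻¹ • ∑ i, (c * k (h⁻¹ • (r.2 - r.1 i))) • g (r.1 i))
      (μ.prod (volume.withDensity fun w => ENNReal.ofReal (ρ w))) := by
  refine ⟨hf.aestronglyMeasurable, ?_⟩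
  have hkm : ∀ x, Measurable fun w => ‖k (h⁻¹ • (w - x))‖ₑ := fun x =>
    (hk_meas.comp (by fun_prop)).enorm
  have hkI : ∫⁻ w, ‖k (h⁻¹ • w)‖ₑ ≠ ⊤ := by
    have := (integrable_comp_inv_smul_sub hk hh 0).2
    simp only [sub_zero] at this
    exact this.ne
  calc ∫⁻ r, ‖(ρ r.2)⁻¹ • ∑ i, (c * k (h⁻¹ • (r.2 - r.1 i))) • g (r.1 i)‖ₑ
          ∂(μ.prod (volume.withDensity fun w => ENNReal.ofReal (ρ w)))
      = ∫⁻ x, ∫⁻ w, ‖(ρ w)⁻¹ • ∑ i, (c * k (h⁻¹ • (w - x i))) • g (x i)‖ₑ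
          ∂(volume.withDensity fun w => ENNReal.ofReal (ρ w)) ∂μ :=
        lintegral_prod _ hf.enorm.aemeasurable
    _ ≤ ∫⁻ x, ∑ i, ‖c‖ₑ * (∫⁻ w, ‖k (h⁻¹ • w)‖ₑ) * ‖g (x i)‖ₑ ∂μ := by
        refine lintegral_mono fun x => (lintegral_withDensity_inv_smul_le hρ _).trans ?_
        refine (lintegral_mono fun w => enorm_sum_le _ _).trans ?_
        simp_rw [enorm_smul, enorm_mul]
        rw [lintegral_finsetSum]
        · refine Finset.sum_le_sum fun i _ => ?_
          rw [lintegral_mul_const _ ((hkm (x i)).const_mul _), lintegral_const_mul _ (hkm (x i)),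
            lintegral_comp_inv_smul_sub]
        · exact fun i _ => ((hkm (x i)).const_mul _).mul_const _
    _ = ∑ i, ‖c‖ₑ * (∫⁻ w, ‖k (h⁻¹ • w)‖ₑ) * ∫⁻ x, ‖g (x i)‖ₑ ∂μ := by
        rw [lintegral_finsetSum' _ fun i _ => (hg i).1.enorm.const_mul _]
        refine Finset.sum_congr rfl fun i _ => lintegral_const_mul'' _ (hg i).1.enorm
    _ < ⊤ := by
        refine ENNReal.sum_lt_top.2 fun i _ => ?_
        exact ENNReal.mul_lt_top (ENNReal.mul_lt_top enorm_lt_top hkI.lt_top) (hg i).2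

/-- The estimator is integrable, and its conditional bias is the sum over all data points of the
mass that the rescaled smoothing kernel loses outside the cube. -/
theorem smoothedEstimator_integrable_and_conditionalBias_eq {Ω : Type*} [MeasurableSpace Ω]
    {P : Measure Ω} [IsProbabilityMeasure P] {d m : ℕ} {γ : Measure (Fin d → ℝ)}
    {z : ℕ → Ω → Fin d → ℝ} (hz_meas : ∀ i, Measurable (z i)) (hz_law : ∀ i, P.map (z i) = γ)
    {L : (Fin d → ℝ) → EuclideanSpace ℝ (Fin m) → ℝ} {θ : EuclideanSpace ℝ (Fin m)}
    (hL_int : Integrable (fun x => gradient (L x) θ) γ)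
    {k : (Fin d → ℝ) → ℝ} (hk_meas : Measurable k) (hk_int : Integrable k)
    {h : ℝ} (hh : 0 < h)
    {q : Fin d → ℝ → ℝ} (hq_meas : ∀ j, Measurable (q j)) (hq_nonneg : ∀ j t, 0 ≤ q j t)
    (hq_out : ∀ j, ∀ t ∉ Set.Icc (-1 : ℝ) 1, q j t = 0)
    (hq_int : ∀ j, Integrable (q j))
    (hq_pos : ∀ j, ∀ᵐ t ∂(volume.restrict (Set.Icc (-1 : ℝ) 1)), 0 < q j t)
    {e : ℕ ≃ (Fin d →₀ ℕ)} {p : ℕ} (hp : 1 ≤ p) (N : ℕ)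
    {A : Ω → Finset (Fin d → ℝ)} (hA_dpp : IsDPP P A (opeKernel q e p) (densityMeasure q))
    (hA_indep : Indep (dataSigma z N)
      (MeasurableSpace.comap A (configurationSigma (Fin d → ℝ))) P) :
    Integrable (fun ω => smoothedEstimator L θ k h q e p (dataset z N ω) (A ω)) P ∧
      ∀ᵐ ω ∂P, conditionalBias P L θ k h q e p z N A ω =
        (N : ℝ)⁻¹ • ∑ i : Fin N,
          ((∫ w in cube d, (h ^ d)⁻¹ * k (h⁻¹ • (w - z i ω))) - 1) • gradient (L (z i ω)) θ := by
  have := isFiniteMeasure_densityMeasure hq_int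
  set ρ : (Fin d → ℝ) → ℝ := fun w => prodDensity q w * opeKernel q e p w w with hρ_def
  have hρ : Measurable ρ := (measurable_prodDensity hq_meas).mul (measurable_opeKernel_self e p)
  have hρ_out : ∀ w ∉ cube d, ρ w = 0 := fun w hw => by
    rw [hρ_def]
    simp [prodDensity_eq_zero hq_out hw]
  have hρ_pos : ∀ᵐ w, w ∈ cube d → 0 < ρ w := by
    filter_upwards [ae_prodDensity_pos hq_pos,
      ae_opeKernel_self_pos hq_meas hq_out hq_int hq_pos e hp] with w h1 h2 hw
    exact mul_pos (h1 hw) h2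
  -- The type `Configuration` selects the point process σ-algebra instead of the instance on
  -- `Finset`.
  let Y : Ω → Configuration (Fin d → ℝ) := A
  have hY : Measurable Y := hA_dpp.measurable
  have hX : Measurable (dataset z N) := measurable_pi_lambda _ fun i => hz_meas i
  have hXY : IndepFun (dataset z N) Y P := (IndepFun_iff_Indep _ _ _).2 hA_indep
  have hν : countingKernel (Fin d → ℝ) ∘ₘ P.map Y =
      volume.withDensity fun w => ENNReal.ofReal (ρ w) := by
    rw [IsDPP.intensity (S := Y) hA_dpp (opeKernel_self_nonneg e p), densityMeasure,
      ← withDensity_mul _ (measurable_prodDensity hq_meas).ennreal_ofReal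
        (measurable_opeKernel_self e p).ennreal_ofReal]
    congr 1
    ext w
    exact (ENNReal.ofReal_mul (prodDensity_nonneg hq_nonneg w)).symm
  -- The gradient is only a.e. strongly measurable for `γ`; a measurable version makes the integrand
  -- jointly measurable, and almost surely agrees with it at all data points.
  set g := hL_int.1.mk _ with hg_def
  have hg : Measurable g := hL_int.1.stronglyMeasurable_mk.measurable
  have hgγ : (fun x => gradient (L x) θ) =ᵐ[γ] g := hL_int.1.ae_eq_mk
  have hg_ae : ∀ᵐ ω ∂P, ∀ i, gradient (L (z i ω)) θ = g (z i ω) := by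
    refine ae_all_iff.2 fun i => ?_
    rw [← hz_law i] at hgγ
    exact ae_of_ae_map (hz_meas i).aemeasurable hgγ
  have hg_int : ∀ i : Fin N, Integrable (fun x : Fin N → Fin d → ℝ => g (x i))
      (P.map (dataset z N)) := by
    intro i
    refine (integrable_map_measure (hg.comp (measurable_pi_apply i)).aestronglyMeasurable
      hX.aemeasurable).2 ?_
    have h1 : Integrable g (P.map (z i)) := hz_law i ▸ hL_int.congr hgγ
    exact h1.comp_measurable (hz_meas i)
  set c : ℝ := ((N : ℝ) * h ^ d)⁻¹ with hc
  have hf : StronglyMeasurable fun r : (Fin N → Fin d → ℝ) × (Fin d → ℝ) =>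
      (ρ r.2)⁻¹ • ∑ i, (c * k (h⁻¹ • (r.2 - r.1 i))) • g (r.1 i) := by
    refine Measurable.stronglyMeasurable ?_
    refine (hρ.comp measurable_snd).inv.smul (Finset.measurable_sum _ fun i _ => ?_)
    exact ((hk_meas.comp (by fun_prop)).const_mul c).smul (hg.comp (by fun_prop))
  have hfi := integrable_reweighted_smoothing hk_meas hk_int hh hρ hg_int c hf
  rw [← hν] at hfi
  have : SFinite (countingKernel (Fin d → ℝ) ∘ₘ P.map Y) := hν ▸ inferInstance
  have hest : (fun ω => ∫ w, (ρ w)⁻¹ • ∑ i, (c * k (h⁻¹ • (w - dataset z N ω i))) •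
      g (dataset z N ω i) ∂(countingKernel _ (Y ω))) =ᵐ[P]
      fun ω => smoothedEstimator L θ k h q e p (dataset z N ω) (A ω) := by
    filter_upwards [hg_ae] with ω hω
    rw [integral_countingKernel]
    refine Finset.sum_congr rfl fun w _ => ?_
    simp only [smoothedGradient, dataset, Finset.smul_sum, hω, mul_smul, hc, hρ_def]
  refine ⟨(integrable_integral_kernel_of_indepFun hX hY hXY hf hfi).congr hest, ?_⟩
  have hcond := condExp_integral_kernel_of_indepFun hX hY hXY hf hfi
  filter_upwards [hcond, condExp_congr_ae (m := dataSigma z N) hest, hg_ae] with ω h1 h2 h3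
  rw [conditionalBias, ← h2, h1, hν,
    integral_withDensity_inv_smul hρ (measurableSet_cube d) hρ_pos hρ_out,
    integral_finsetSum _ fun i _ => ((integrable_comp_inv_smul_sub hk_int hh _).integrableOn.const_mul
      c).smul_const _, empiricalGradient, Finset.smul_sum, Finset.smul_sum, ← Finset.sum_sub_distrib]
  refine Finset.sum_congr rfl fun i _ => ?_
  simp only [dataset]
  rw [integral_smul_const, integral_const_mul, integral_const_mul, h3, sub_smul, one_smul, smul_sub,
    smul_smul, hc, mul_inv, mul_assoc]

/-! ### Localization of the bias at the boundary, and its vanishing for large `N` -/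

theorem proposition3 {Ω : Type*} [MeasurableSpace Ω] (P : Measure Ω) [IsProbabilityMeasure P]
    {d m : ℕ}
    -- the law of the data
    (γ : Measure (Fin d → ℝ)) [IsProbabilityMeasure γ]
    (hγ_supp : γ.support ⊆ interior (cube d))
    (hγ_ac : γ ≪ volume)
    (hγ_low : ∃ c : ℝ, 0 < c ∧
      ∀ᵐ x ∂(volume.restrict γ.support), ENNReal.ofReal c ≤ γ.rnDeriv volume x)
    -- the data: an i.i.d. sample
    (z : ℕ → Ω → Fin d → ℝ) (hz_meas : ∀ i, Measurable (z i))
    (hz_indep : iIndepFun z P) (hz_law : ∀ i, P.map (z i) = γ)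
    -- the loss
    (L : (Fin d → ℝ) → EuclideanSpace ℝ (Fin m) → ℝ) (θ : EuclideanSpace ℝ (Fin m))
    (hL_diff : ∀ x ∈ γ.support, DifferentiableAt ℝ (L x) θ)
    (hL_int : Integrable (fun x => gradient (L x) θ) γ)
    -- the smoothing kernel and the bandwidth
    (k : (Fin d → ℝ) → ℝ) (hk_meas : Measurable k) (hk_int : Integrable k)
    (hk_one : ∫ x, k x = 1) (hk_supp : HasCompactSupport k)
    (h : ℕ → ℝ) (hh_pos : ∀ N, 0 < h N) (hh_lim : Tendsto h atTop (𝓝 0))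
    -- the separable density of the reference measure
    (q : Fin d → ℝ → ℝ) (hq_meas : ∀ j, Measurable (q j)) (hq_nonneg : ∀ j t, 0 ≤ q j t)
    (hq_out : ∀ j, ∀ t ∉ Set.Icc (-1 : ℝ) 1, q j t = 0)
    (hq_int : ∀ j, Integrable (q j)) (hq_one : ∀ j, ∫ t, q j t = 1)
    (hq_pos : ∀ j, ∀ᵐ t ∂(volume.restrict (Set.Icc (-1 : ℝ) 1)), 0 < q j t)
    (hq_bdd : ∃ C : ℝ, ∀ x ∈ γ.support, prodDensity q x ≤ C)
    -- the ordering of the monomials, and the sample of the orthogonal polynomial ensemble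
    (e : ℕ ≃ (Fin d →₀ ℕ)) (p : ℕ → ℕ) (hp : ∀ N, 1 ≤ p N)
    (A : ℕ → Ω → Finset (Fin d → ℝ))
    (hA_dpp : ∀ N, IsDPP P (A N) (opeKernel q e (p N)) (densityMeasure q))
    (hA_indep : ∀ N, Indep (dataSigma z N)
      (MeasurableSpace.comap (A N) (configurationSigma (Fin d → ℝ))) P) :
    -- the estimator is integrable
    (∀ N, 1 ≤ N → Integrable
      (fun ω => smoothedEstimator L θ k (h N) q e (p N) (dataset z N ω) (A N ω)) P) ∧
    -- the bias only comes from the data points close to the boundary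
    (∀ R : ℝ, (∀ x, R < ‖x‖ → k x = 0) → ∀ N, 1 ≤ N → ∀ᵐ ω ∂P,
      conditionalBias P L θ k (h N) q e (p N) z N (A N) ω =
        (N : ℝ)⁻¹ • ∑ i ∈ (Finset.univ : Finset (Fin N)).filter
            (fun i => Metric.infDist (dataset z N ω i) (frontier (cube d)) ≤ R * h N),
          ((∫ w in cube d, (h N ^ d)⁻¹ * k ((h N)⁻¹ • (w - dataset z N ω i))) - 1) •
            gradient (L (dataset z N ω i)) θ) ∧
    -- the bias is of order `p h / N` in probability
    IsBigOInProbability P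
      (fun N ω => conditionalBias P L θ k (h N) q e (p N) z N (A N) ω)
      (fun N => (p N : ℝ) * h N / N) := by
  have key := fun N => smoothedEstimator_integrable_and_conditionalBias_eq hz_meas hz_law hL_int
    hk_meas hk_int (hh_pos N) hq_meas hq_nonneg hq_out hq_int hq_pos (hp N) N (hA_dpp N)
    (hA_indep N)
  have hz_supp : ∀ᵐ ω ∂P, ∀ i, z i ω ∈ γ.support := by
    refine ae_all_iff.2 fun i => ?_
    have hγ : ∀ᵐ x ∂(P.map (z i)), x ∈ γ.support := by
      rw [hz_law i]
      exact Measure.support_mem_ae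
    exact ae_of_ae_map (hz_meas i).aemeasurable hγ
  -- `M = 1` is arbitrary: the bias is almost surely zero for large `N`.
  refine ⟨fun N _ => (key N).1, fun R hR N _ => ?_, fun ε _ => ⟨1, one_pos, ?_⟩⟩
  · filter_upwards [(key N).2, hz_supp] with ω hω hsupp
    rw [hω]
    congr 1
    symm
    refine Finset.sum_filter_of_ne fun i _ hne => ?_
    by_contra! hlt
    refine hne ?_
    simp only [dataset] at hlt ⊢
    rw [setIntegral_rescaled_eq_one hk_one (hh_pos N) hR
      (closedBall_subset_of_lt_infDist_frontier (hγ_supp (hsupp i))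
        (mul_nonneg (radius_nonneg hk_one hR) (hh_pos N).le) hlt), sub_self, zero_smul]
  · obtain ⟨R, hR⟩ := hk_supp.isCompact.isBounded.subset_closedBall 0
    have hkR : ∀ x, R < ‖x‖ → k x = 0 := fun x hx => image_eq_zero_of_notMem_tsupport fun hmem =>
      absurd (hR hmem) (by simpa using hx)
    have hcompact : IsCompact γ.support :=
      isCompact_Icc.of_isClosed_subset Measure.isClosed_support
        (hγ_supp.trans interior_subset)
    -- Compactness gives one margin `δ` for all data points, so `R * h N < δ` puts every kernel
    -- window inside the cube at once.
    obtain ⟨δ, hδ, hδ_sub⟩ := hcompact.exists_cthickening_subset_open isOpen_interior hγ_supp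
    have hlim : Tendsto (fun N => R * h N) atTop (𝓝 0) := by
      simpa using hh_lim.const_mul R
    filter_upwards [hlim.eventually_lt_const hδ] with N hN
    -- The rate is nonnegative, so exceeding it forces a nonzero bias, which is a null event.
    refine (measure_mono_null (t := {ω | ¬ conditionalBias P L θ k (h N) q e (p N) z N (A N) ω = 0})
      (fun ω hω h0 => ?_) (ae_iff.1 ?_)).trans_le zero_le
    · simp only [Set.mem_ofPred_eq, h0, norm_zero] at hω
      exact absurd hω (not_lt.2 (mul_nonneg zero_le_one (div_nonneg (mul_nonneg
        (Nat.cast_nonneg _) (hh_pos N).le) (Nat.cast_nonneg _))))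
    · filter_upwards [(key N).2, hz_supp] with ω hω hsupp
      rw [hω, Finset.sum_eq_zero, smul_zero]
      intro i _
      have hball : Metric.closedBall (z i ω) (R * h N) ⊆ cube d :=
        (Metric.closedBall_subset_closedBall hN.le).trans
          ((Metric.closedBall_subset_cthickening (hsupp i) δ).trans
            (hδ_sub.trans interior_subset))
      rw [setIntegral_rescaled_eq_one hk_one (hh_pos N) hkR hball, sub_self, zero_smul]
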